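/- Let $(X,d)$ be a separable complete metric space, and write $B(x,r)=\{y\in X: d(x,y)\le r\}$. For $x_1,x_2\in X$ and $r_1,r_2>0$ write $(x_2,r_2)\le_s(x_1,r_1)$ if $r_2+d(x_1,x_2)\le r_1$. For $\beta\in(0,1)$ and $T\subseteq X$, the $\beta$-BMS (Banach--Mazur--Schmidt) game with target set $T$ is played as follows. Bob starts by choosing a pair $\omega_1=(x_1,r_1)\in X\times(0,\infty)$; then Alice and Bob alternately choose pairs $\omega'_n=(x'_n,r'_n)$ (Alice) and $\omega_{n+1}=(x_{n+1},r_{n+1})$ (Bob) in $X\times(0,\infty)$ such that $\omega_{n+1}\le_s\omega'_n\le_s\omega_n$, where Alice must moreover choose $r'_n=\beta r_n$. Alice wins if the unique point of $\bigcap_n B(x_n,r_n)$ lies in $T$; otherwise Bob wins. The set $T$ is $\beta$-BMS winning if Alice has a winning strategy in this game, and BMS-winning if it is $\beta$-BMS winning for all sufficiently small $\beta\in(0,1)$. Let $\delta\ge 0$, and suppose that $X$ is Ahlfors $\delta$-regular, i.e. there are a Borel measure $\mu$ on $X$ whose support is $X$ and a constant $C>0$ such that $C^{-1}r^\delta\le\mu(B(x,r))\le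 Cr^\delta$ for all $x\in X$ and $0<r\le 1$. If $T\subseteq X$ is BMS-winning, then both the Hausdorff dimension and the packing dimension of $X\setminus T$ are strictly less than $\delta$. (Here, when $\delta=0$, the empty set is regarded as having dimension $-\infty$, so that the claim for $\delta=0$ is that $X\setminus T=\emptyset$.) -/

import Mathlib

open scoped NNReal ENNReal

/-- A formal ball of `X`: a centre together with a positive radius. -/
@[ext]
structure FormalBall (X : Type*) where
  center : X
  radius : ℝ
  radius_pos : 0 < radius

namespace FormalBall

variable {X : Type*} [MetricSpace X]

/-- The closed ball of `X` described by a formal ball. -/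
def toSet (a : FormalBall X) : Set X := Metric.closedBall a.center a.radius

/-- `b ≤ a` means `b.radius + dist a.center b.center ≤ a.radius`. -/
instance : PartialOrder (FormalBall X) where
  le b a := b.radius + dist a.center b.center ≤ a.radius
  le_refl a := by simp
  le_trans c b a hcb hba := by
    have := dist_triangle a.center b.center c.center
    linarith
  le_antisymm b a hba hab := by
    have h0 := dist_nonneg (x := a.center) (y := b.center)
    rw [dist_comm] at hab
    have h : dist a.center b.center = 0 := by linarith
    ext
    · exact (dist_eq_zero.mp h).symm
    · linarith

end FormalBall

/-- `T` is `β`-BMS winning: Alice has a winning strategy in the `β`-Banach–Mazur–Schmidt game with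
target set `T`. Bob's moves are `ω 0, ω 1, …` and Alice's answers are `ω' 0, ω' 1, …`, in the order
`ω 0, ω' 0, ω 1, ω' 1, …`. A strategy `σ` for Alice computes her `n`-th answer from Bob's moves
`ω 0, …, ω n`. Bob's moves are legal if `ω (n + 1) ≤ ω' n`; Alice's are legal if `ω' n ≤ ω n` and
the radius of `ω' n` is `β` times that of `ω n`. The strategy is winning if Alice's answers are
legal as long as Bob has played legally, and if in each infinite legal play the intersection of the
balls meets `T` (in a complete space this intersection is a single point). -/
def IsBMSWinningWith {X : Type*} [MetricSpace X] (β : ℝ) (T : Set X) : Prop :=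
  ∃ σ : (n : ℕ) → (Fin (n + 1) → FormalBall X) → FormalBall X,
    ∀ ω ω' : ℕ → FormalBall X, (∀ n, ω' n = σ n (fun i => ω i)) →
      (∀ n, (∀ k < n, ω (k + 1) ≤ ω' k) →
        ω' n ≤ ω n ∧ (ω' n).radius = β * (ω n).radius) ∧
      ((∀ n, ω (n + 1) ≤ ω' n) → ((⋂ n, (ω n).toSet) ∩ T).Nonempty)

/-- `T` is BMS-winning: it is `β`-BMS winning for all sufficiently small `β ∈ (0, 1)`. -/
def IsBMSWinning {X : Type*} [MetricSpace X] (T : Set X) : Prop :=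
  ∃ β₀ : ℝ, 0 < β₀ ∧ ∀ β : ℝ, 0 < β → β < 1 → β < β₀ → IsBMSWinningWith β T

/-- The closed set `K` is Ahlfors `s`-regular. -/
def IsAhlforsRegular {X : Type*} [MetricSpace X] [MeasurableSpace X] (s : ℝ≥0) (K : Set X) : Prop :=
  IsClosed K ∧ ∃ μ : MeasureTheory.Measure X, μ.support = K ∧
    ∃ C : ℝ, 0 < C ∧ ∀ x ∈ K, ∀ r : ℝ, 0 < r → r ≤ 1 →
      ENNReal.ofReal (C⁻¹ * r ^ (s : ℝ)) ≤ μ (Metric.closedBall x r) ∧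
        μ (Metric.closedBall x r) ≤ ENNReal.ofReal (C * r ^ (s : ℝ))

section Packing

variable {X : Type*} [MetricSpace X]

/-- `P` is a (finite) `ε`-packing of `E`: a family of pairwise disjoint closed balls with centres
in `E` and radii in `(0, ε]`. -/
def IsPacking (ε : ℝ) (E : Set X) (P : Finset (X × ℝ)) : Prop :=
  (∀ p ∈ P, p.1 ∈ E ∧ 0 < p.2 ∧ p.2 ≤ ε) ∧
    (P : Set (X × ℝ)).PairwiseDisjoint (fun p => Metric.closedBall p.1 p.2)

/-- The `s`-dimensional packing premeasure of `E`: the limit as `ε → 0` of the supremum of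
`∑ (2 r) ^ s` over all `ε`-packings of `E`. The supremum is monotone in `ε`, so the limit is an
infimum, and finite packings give the same supremum as countable ones. -/
noncomputable def packingPremeasure (s : ℝ≥0) (E : Set X) : ℝ≥0∞ :=
  ⨅ (ε : ℝ) (_ : 0 < ε), ⨆ (P : Finset (X × ℝ)) (_ : IsPacking ε E P),
    ∑ p ∈ P, ENNReal.ofReal ((2 * p.2) ^ (s : ℝ))

/-- The `s`-dimensional packing (outer) measure of `E`. -/
noncomputable def packingMeasure (s : ℝ≥0) (E : Set X) : ℝ≥0∞ :=
  ⨅ (F : ℕ → Set X) (_ : E ⊆ ⋃ i, F i), ∑' i, packingPremeasure s (F i)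

/-- The packing dimension of `E`. -/
noncomputable def packingDim (E : Set X) : ℝ≥0∞ :=
  ⨅ (s : ℝ≥0) (_ : packingMeasure s E = 0), (s : ℝ≥0∞)

end Packing

/-! Fix one `β` for which Alice wins, with strategy `σ`, and restrict Bob to a sequence `b` of
formal balls approximating all others. If every position around `x` (with `x` in Alice's open balls)
could be continued around `x`, the resulting infinite play would shrink to `x`, forcing `x ∈ T`. So
each `x ∉ T` gets stuck at one of countably many positions. The set stuck at a position is porous:
near a stuck `y` Bob may play almost the whole ball of radius `r` about `y`, and Alice's answer, of
radius at least `β / 2 * r`, contains no stuck point in its interior. The hole size `β / 2` is the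
same for all positions; only the threshold scale varies, and a countable splitting makes it uniform
on each piece.

In a regular space, refining the scale by a fixed factor shrinks the measure of the thickening of
such a piece by a fixed ratio. That ratio depends only on `δ`, `C` and the hole size, so a single `s
< δ` gives finite `s`-packing premeasure on all pieces. Countable unions then keep both dimensions
below `δ`. For `δ = 0` balls have measure bounded below, so the decay leaves only empty pieces. -/

/-- `E` has a hole at scale `r` around `y`, of relative size `α`. -/
def HasHole {X : Type*} [MetricSpace X] (α : ℝ) (E : Set X) (y : X) (r : ℝ) : Prop :=
  ∃ z, dist z y + α * r ≤ r ∧ Disjoint (Metric.ball z (α * r)) E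

/-- `E` is porous, with relative hole size `α`, at every scale below `ρ`. -/
def IsUniformlyPorous {X : Type*} [MetricSpace X] (α ρ : ℝ) (E : Set X) : Prop :=
  ∀ y ∈ E, ∀ r, 0 < r → r < ρ → HasHole α E y r

theorem HasHole.mono {X : Type*} [MetricSpace X] {α : ℝ} {E F : Set X} {y : X} {r : ℝ}
    (h : HasHole α F y r) (hEF : E ⊆ F) : HasHole α E y r := by
  obtain ⟨z, hz, hd⟩ := h
  exact ⟨z, hz, hd.mono_right hEF⟩

/-- Alice's `n`-th answer when Bob plays `ω`. -/
def answer {X : Type*} (σ : (n : ℕ) → (Fin (n + 1) → FormalBall X) → FormalBall X) (n : ℕ)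
    (ω : ℕ → FormalBall X) : FormalBall X := σ n (fun i => ω i)

theorem answer_congr {X : Type*} (σ : (n : ℕ) → (Fin (n + 1) → FormalBall X) → FormalBall X) {n : ℕ}
    {ω ω₂ : ℕ → FormalBall X} (h : ∀ i ≤ n, ω i = ω₂ i) : answer σ n ω = answer σ n ω₂ := by
  unfold answer
  congr 1
  funext i
  exact h i (Nat.lt_succ_iff.1 i.2)

/-! ### The game: positions without continuation, and porosity. -/

section Game

variable {X : Type*} [MetricSpace X]

/-- Formal balls can be approximated from inside by those of a fixed sequence. -/
theorem exists_formalBall_seq [TopologicalSpace.SeparableSpace X] [Nonempty X] :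
    ∃ b : ℕ → FormalBall X, ∀ (y : X) (r : ℝ), 0 < r →
      ∃ i, r / 2 < (b i).radius ∧ (b i).radius + dist (b i).center y ≤ r := by
  obtain ⟨e, he⟩ := exists_surjective_nat (ℕ × {q : ℚ // 0 < q})
  refine ⟨fun i => ⟨TopologicalSpace.denseSeq X (e i).1, ((e i).2 : ℚ),
    by exact_mod_cast (e i).2.2⟩, fun y r hr => ?_⟩
  obtain ⟨q, hq1, hq2⟩ := exists_rat_btwn (half_lt_self hr)
  have hq : 0 < q := by
    have : (0 : ℝ) < q := by linarith
    exact_mod_cast this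
  obtain ⟨j, hj⟩ := (TopologicalSpace.denseRange_denseSeq X).exists_dist_lt y (sub_pos.2 hq2)
  obtain ⟨i, hi⟩ := he (j, ⟨q, hq⟩)
  refine ⟨i, ?_, ?_⟩
  · simpa [hi] using hq1
  · rw [dist_comm] at hj
    simp only [hi]
    linarith

/-- The first `n` moves of Bob are legal, and `x` lies in the open balls of the first `n` answers
of Alice. -/
def IsPositionAround (σ : (n : ℕ) → (Fin (n + 1) → FormalBall X) → FormalBall X) (x : X) (n : ℕ)
    (ω : ℕ → FormalBall X) : Prop :=
  (∀ k, k + 1 < n → ω (k + 1) ≤ answer σ k ω) ∧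
    ∀ k < n, x ∈ Metric.ball (answer σ k ω).center (answer σ k ω).radius

/-- The points around which the position can be reached, but cannot be continued by a move from
the sequence `b`. -/
def stuckSet (σ : (n : ℕ) → (Fin (n + 1) → FormalBall X) → FormalBall X) (b : ℕ → FormalBall X)
    (n : ℕ) (f : ℕ →₀ ℕ) : Set X :=
  {x | IsPositionAround σ x n (fun k => b (f k)) ∧
    ∀ i, ¬ IsPositionAround σ x (n + 1) (fun k => b (f.update n i k))}

/-- Otherwise a continuation always exists, and iterating it gives a legal play in which `x` stays
in all of Alice's balls. Their radii tend to `0`, so the point of `T` in the intersection is `x`. -/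
theorem exists_mem_stuckSet {β : ℝ} (hβ : 0 < β) (hβ1 : β < 1) {T : Set X}
    {σ : (n : ℕ) → (Fin (n + 1) → FormalBall X) → FormalBall X}
    (hσ : ∀ ω ω' : ℕ → FormalBall X, (∀ n, ω' n = σ n (fun i => ω i)) →
      (∀ n, (∀ k < n, ω (k + 1) ≤ ω' k) →
        ω' n ≤ ω n ∧ (ω' n).radius = β * (ω n).radius) ∧
      ((∀ n, ω (n + 1) ≤ ω' n) → ((⋂ n, (ω n).toSet) ∩ T).Nonempty))
    (b : ℕ → FormalBall X) {x : X} (hx : x ∉ T) : ∃ n f, x ∈ stuckSet σ b n f := by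
  by_contra! H
  have H' : ∀ n f, ∃ i, IsPositionAround σ x n (fun k => b (f k)) →
      IsPositionAround σ x (n + 1) (fun k => b (Finsupp.update f n i k)) := by
    intro n f
    by_contra! h
    exact H n f ⟨(h 0).1, fun i => (h i).2⟩
  choose c hc using H'
  -- Only the first `n` entries of `S n` matter; the default `0` beyond them is never read. Finite
  -- support keeps the set of positions countable.
  let S : ℕ → (ℕ →₀ ℕ) := fun n => Nat.rec 0 (fun n f => f.update n (c n f)) n
  have hS : ∀ n, S (n + 1) = (S n).update n (c n (S n)) := fun n => rfl
  have hpos : ∀ n, IsPositionAround σ x n (fun k => b (S n k)) := by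
    intro n
    induction n with
    | zero => exact ⟨fun k hk => by omega, fun k hk => by omega⟩
    | succ n ih => exact hc n (S n) ih
  have hstab : ∀ k m, S (k + 1 + m) k = S (k + 1) k := by
    intro k m
    induction m with
    | zero => rfl
    | succ m ih =>
      rw [← ih, ← add_assoc, hS, Finsupp.update_apply, if_neg (by omega)]
  set ω : ℕ → FormalBall X := fun n => b (S (n + 1) n) with hω
  have hagree : ∀ m k, k < m → b (S m k) = ω k := by
    intro m k hk
    obtain ⟨j, rfl⟩ := Nat.exists_eq_add_of_le (Nat.succ_le_of_lt hk)
    simp only [hω]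
    rw [← hstab k j]
  have hans : ∀ m k, k < m → answer σ k (fun k => b (S m k)) = answer σ k ω := by
    intro m k hk
    exact answer_congr σ fun i hi => hagree m i (by omega)
  have hleg : ∀ n, ω (n + 1) ≤ answer σ n ω := by
    intro n
    have := (hpos (n + 2)).1 n (by omega)
    rwa [hans (n + 2) n (by omega)] at this
  have hmem : ∀ n, x ∈ Metric.ball (answer σ n ω).center (answer σ n ω).radius := by
    intro n
    have := (hpos (n + 1)).2 n (by omega)
    rwa [hans (n + 1) n (by omega)] at this
  obtain ⟨h1, h2⟩ := hσ ω (fun n => answer σ n ω) (fun n => rfl)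
  obtain ⟨y, hy, hyT⟩ := h2 hleg
  have hA := fun n => h1 n fun k _ => hleg k
  have hrad : ∀ n, (ω n).radius ≤ β ^ n * (ω 0).radius := by
    intro n
    induction n with
    | zero => simp
    | succ n ih =>
      have e1 : (ω (n + 1)).radius + _ ≤ (answer σ n ω).radius := hleg n
      have e2 := (hA n).2
      have e3 := dist_nonneg (x := (answer σ n ω).center) (y := (ω (n + 1)).center)
      have e4 := mul_le_mul_of_nonneg_left ih hβ.le
      rw [pow_succ']
      linarith
  have hdist : ∀ n, dist x y ≤ 2 * (β ^ n * (ω 0).radius) := by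
    intro n
    have e1 : (answer σ n ω).radius + dist (ω n).center (answer σ n ω).center ≤ (ω n).radius :=
      (hA n).1
    have e2 := Metric.mem_ball.1 (hmem n)
    have e3 : dist y (ω n).center ≤ (ω n).radius := Set.mem_iInter.1 hy n
    have e4 := dist_triangle x (answer σ n ω).center (ω n).center
    have e5 := dist_triangle_right x y (ω n).center
    rw [dist_comm (ω n).center] at e1
    linarith [hrad n]
  have hlim : Filter.Tendsto (fun n : ℕ => 2 * (β ^ n * (ω 0).radius)) Filter.atTop (nhds 0) := by
    simpa using ((tendsto_pow_atTop_nhds_zero_of_lt_one hβ.le hβ1).mul_const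
      (ω 0).radius).const_mul 2
  have h0 : dist x y ≤ 0 := ge_of_tendsto' hlim hdist
  exact hx (dist_le_zero.1 h0 ▸ hyT)

theorem hasHole_stuckSet {β : ℝ} (hβ : 0 < β) {T : Set X}
    {σ : (n : ℕ) → (Fin (n + 1) → FormalBall X) → FormalBall X}
    (hσ : ∀ ω ω' : ℕ → FormalBall X, (∀ n, ω' n = σ n (fun i => ω i)) →
      (∀ n, (∀ k < n, ω (k + 1) ≤ ω' k) →
        ω' n ≤ ω n ∧ (ω' n).radius = β * (ω n).radius) ∧
      ((∀ n, ω (n + 1) ≤ ω' n) → ((⋂ n, (ω n).toSet) ∩ T).Nonempty))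
    {b : ℕ → FormalBall X}
    (hb : ∀ (y : X) (r : ℝ), 0 < r →
      ∃ i, r / 2 < (b i).radius ∧ (b i).radius + dist (b i).center y ≤ r)
    {n : ℕ} {f : ℕ →₀ ℕ} {y : X} (hy : y ∈ stuckSet σ b n f) :
    ∃ ρ > 0, ∀ r, 0 < r → r < ρ → HasHole (β / 2) (stuckSet σ b n f) y r := by
  -- Since `y` lies in the open ball of the last answer, there is room `ρ` for Bob's move around
  -- `y`. For `n = 0` the first move is unrestricted.
  obtain ⟨ρ, hρ, hρ'⟩ : ∃ ρ > 0, ∀ k, k + 1 = n →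
      ρ + dist y (answer σ k (fun k => b (f k))).center
        ≤ (answer σ k (fun k => b (f k))).radius := by
    rcases n with _ | m
    · exact ⟨1, one_pos, fun k hk => by omega⟩
    · refine ⟨_, sub_pos.2 (Metric.mem_ball.1 (hy.1.2 m (by omega))), fun k hk => ?_⟩
      obtain rfl : k = m := by omega
      linarith
  refine ⟨ρ, hρ, fun r hr hrρ => ?_⟩
  obtain ⟨i, hi1, hi2⟩ := hb y r hr
  set ω : ℕ → FormalBall X := fun k => b (f.update n i k) with hω
  have hlt : ∀ k < n, ω k = b (f k) := by
    intro k hk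
    simp only [hω, Finsupp.update_apply, if_neg hk.ne]
  have hn : ω n = b i := by simp [hω, Finsupp.update_apply]
  have hans : ∀ k < n, answer σ k ω = answer σ k (fun k => b (f k)) := fun k hk =>
    answer_congr σ fun j hj => hlt j (by omega)
  have hleg : ∀ k < n, ω (k + 1) ≤ answer σ k ω := by
    intro k hk
    rw [hans k hk]
    rcases (Nat.succ_le_of_lt hk).lt_or_eq with h | h
    · rw [hlt _ h]
      exact hy.1.1 k h
    · have h' : k + 1 = n := h
      rw [h', hn]
      change (b i).radius + dist _ (b i).center ≤ _
      have e1 := hρ' k h'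
      have e2 := dist_triangle_left (answer σ k (fun k => b (f k))).center (b i).center y
      rw [dist_comm y (b i).center] at e2
      linarith
  obtain ⟨hle, hrad⟩ := (hσ ω (fun n => answer σ n ω) (fun n => rfl)).1 n hleg
  replace hle : (answer σ n ω).radius + dist (ω n).center (answer σ n ω).center ≤ (ω n).radius :=
    hle
  rw [hn] at hle hrad
  have hsmall : β / 2 * r ≤ (answer σ n ω).radius := by
    rw [hrad]
    nlinarith
  refine ⟨(answer σ n ω).center, ?_, ?_⟩
  · have := dist_triangle_left (answer σ n ω).center y (b i).center
    linarith
  · rw [Set.disjoint_left]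
    intro x hxb hx
    refine hx.2 i ⟨fun k hk => hleg k (by omega), fun k hk => ?_⟩
    change x ∈ Metric.ball (answer σ k ω).center (answer σ k ω).radius
    rcases (Nat.lt_succ_iff.1 hk).lt_or_eq with h | rfl
    · rw [hans k h]
      exact hx.1.2 k h
    · exact Metric.ball_subset_ball hsmall hxb

/-- The complement of a winning set is a countable union of small uniformly porous sets, with a
common relative hole size. -/
theorem IsBMSWinningWith.exists_porous_cover [TopologicalSpace.SeparableSpace X]
    {β : ℝ} (hβ : 0 < β) (hβ1 : β < 1) {T : Set X} (hT : IsBMSWinningWith β T) :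
    ∃ E : ℕ → Set X, Tᶜ ⊆ ⋃ i, E i ∧
      ∀ i, (∃ ρ > 0, IsUniformlyPorous (β / 2) ρ (E i)) ∧
        ∀ x ∈ E i, E i ⊆ Metric.closedBall x (1 / 2) := by
  rcases isEmpty_or_nonempty X with hX | hX
  · exact ⟨fun _ => ∅, fun x => (IsEmpty.false x).elim,
      fun i => ⟨⟨1, one_pos, fun y => (IsEmpty.false y).elim⟩, fun y => (IsEmpty.false y).elim⟩⟩
  obtain ⟨σ, hσ⟩ := hT
  obtain ⟨b, hb⟩ := exists_formalBall_seq (X := X)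
  obtain ⟨e, he⟩ := exists_surjective_nat (((ℕ × (ℕ →₀ ℕ)) × ℕ) × ℕ)
  -- The indices are the position (length and moves), the scale below which holes exist, and a dense
  -- centre; radius `1 / 4` makes the diameter at most `1 / 2`.
  let F : ((ℕ × (ℕ →₀ ℕ)) × ℕ) × ℕ → Set X := fun j =>
    {y | y ∈ stuckSet σ b j.1.1.1 j.1.1.2 ∧
      (∀ r, 0 < r → r < 1 / ((j.1.2 : ℝ) + 1) →
        HasHole (β / 2) (stuckSet σ b j.1.1.1 j.1.1.2) y r) ∧
      y ∈ Metric.closedBall (TopologicalSpace.denseSeq X j.2) (1 / 4)}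
  refine ⟨fun i => F (e i), fun x hx => ?_, fun i => ⟨⟨1 / (((e i).1.2 : ℝ) + 1), by positivity,
    fun y hy r hr hr' => (hy.2.1 r hr hr').mono fun z hz => hz.1⟩, fun y hy w hw => ?_⟩⟩
  swap
  · have h1 := Metric.mem_closedBall.1 hy.2.2
    have h2 := Metric.mem_closedBall.1 hw.2.2
    have := dist_triangle_right w y (TopologicalSpace.denseSeq X (e i).2)
    rw [Metric.mem_closedBall]
    linarith
  obtain ⟨n, f, hnf⟩ := exists_mem_stuckSet hβ hβ1 hσ b hx
  obtain ⟨ρ, hρ, hhole⟩ := hasHole_stuckSet hβ hσ hb hnf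
  obtain ⟨k, hk⟩ := exists_nat_one_div_lt hρ
  obtain ⟨j, hj⟩ := (TopologicalSpace.denseRange_denseSeq X).exists_dist_lt x
    (show (0 : ℝ) < 1 / 4 by norm_num)
  obtain ⟨i, hi⟩ := he (((n, f), k), j)
  refine Set.mem_iUnion.2 ⟨i, ?_⟩
  rw [hi]
  exact ⟨hnf, fun r hr hr' => hhole r hr (hr'.trans hk), hj.le⟩

end Game

/-! ### Porous sets in regular spaces: measure decay and dimension. -/

section Dimension

open MeasureTheory Metric

variable {X : Type*} [MetricSpace X]

/-- The bounds on the measure of balls in the definition of Ahlfors regularity. -/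
def HasBallBounds [MeasurableSpace X] (δ : ℝ≥0) (C : ℝ) (μ : Measure X) : Prop :=
  ∀ (x : X) (r : ℝ), 0 < r → r ≤ 1 →
    ENNReal.ofReal (C⁻¹ * r ^ (δ : ℝ)) ≤ μ (closedBall x r) ∧
      μ (closedBall x r) ≤ ENNReal.ofReal (C * r ^ (δ : ℝ))

/-- The decay factor of the measures of thickenings of a porous set. -/
noncomputable def decayRatio (δ : ℝ≥0) (C α : ℝ) : ℝ :=
  C * C * (48 / α) ^ (δ : ℝ) / (1 + C * C * (48 / α) ^ (δ : ℝ))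

theorem decayRatio_pos {δ : ℝ≥0} {C α : ℝ} (hC : 0 < C) (hα : 0 < α) :
    0 < decayRatio δ C α := by
  unfold decayRatio
  positivity

theorem decayRatio_lt_one {δ : ℝ≥0} {C α : ℝ} (hC : 0 < C) (hα : 0 < α) :
    decayRatio δ C α < 1 := by
  unfold decayRatio
  rw [div_lt_one (by positivity)]
  linarith

/-- Enlarged Vitali balls cover the thin thickening, while each original ball has a hole lying in
the thick thickening and missing the thin one. Comparing ball measures gives `c ≤ K * (a - c)` for
the thin and thick measures `c` and `a`, hence the ratio `K / (1 + K)`. -/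
theorem measure_thickening_le [TopologicalSpace.SeparableSpace X] [MeasurableSpace X]
    [BorelSpace X] {δ : ℝ≥0} {C α ρ t : ℝ} {μ : Measure X} (hμ : HasBallBounds δ C μ)
    (hC : 0 < C) (hα : 0 < α) (hα1 : α < 1) {E : Set X} (hE : IsUniformlyPorous α ρ E)
    (ht : 0 < t) (htρ : t < ρ) (ht6 : t ≤ 1 / 6) (hfin : μ (thickening t E) ≠ ⊤) :
    μ (thickening (α / 4 * t) E) ≤ ENNReal.ofReal (decayRatio δ C α) * μ (thickening t E) := by
  obtain ⟨u, huE, hdisj, hcov⟩ := Vitali.exists_disjoint_subfamily_covering_enlargement_closedBall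
    E id (fun _ => t / 2) (t / 2) (fun _ _ => le_rfl) 5 (by norm_num)
  have hu : u.Countable := hdisj.countable_of_nonempty_interior fun y _ =>
    ⟨y, ball_subset_interior_closedBall (mem_ball_self (by positivity))⟩
  have hole : ∀ y ∈ u, HasHole α E y (t / 2) := fun y hy =>
    hE y (huE hy) _ (by positivity) (by linarith)
  choose! z hz hzE using hole
  have hat : α * t < t := by nlinarith
  have hat0 : 0 < α * t := by positivity
  set K : ℝ := C * C * (48 / α) ^ (δ : ℝ) with hK
  have hK0 : 0 < K := by positivity
  have hup : μ (thickening (α / 4 * t) E) ≤ ∑' y : u, μ (closedBall (y : X) (6 * t)) := by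
    refine le_trans (measure_mono fun w hw => ?_) (measure_biUnion_le μ hu fun y => closedBall y (6 * t))
    obtain ⟨e, he, hwe⟩ := mem_thickening_iff.1 hw
    obtain ⟨y, hy, hey⟩ := hcov e he
    refine Set.mem_biUnion hy (mem_closedBall.2 ?_)
    have h1 := mem_closedBall.1 (hey (mem_closedBall_self (by positivity)))
    simp only [id] at h1
    have := dist_triangle w e y
    linarith
  have hsub : ∀ y ∈ u, closedBall (z y) (α * t / 8) ⊆ closedBall y (t / 2) := by
    intro y hy w hw
    rw [mem_closedBall] at hw ⊢
    have := dist_triangle w (z y) y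
    have := hz y hy
    linarith
  have hlow : ∑' y : u, μ (closedBall (z y) (α * t / 8)) ≤
      μ (thickening t E \ thickening (α / 4 * t) E) := by
    rw [← measure_biUnion hu (fun a ha b hb hab => (hdisj ha hb hab).mono (hsub a ha) (hsub b hb))
      (fun _ _ => measurableSet_closedBall)]
    refine measure_mono (Set.iUnion₂_subset fun y hy w hw => ⟨?_, fun hw' => ?_⟩)
    · refine mem_thickening_iff.2 ⟨y, huE hy, ?_⟩
      have := mem_closedBall.1 (hsub y hy hw)
      linarith
    -- The hole at scale `t / 2` has radius `α * t / 2`, which exceeds `α * t / 8 + α * t / 4`.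
    · obtain ⟨e, he, hwe⟩ := mem_thickening_iff.1 hw'
      refine Set.disjoint_left.1 (hzE y hy) (mem_ball.2 ?_) he
      have := dist_triangle_left e (z y) w
      have := mem_closedBall.1 hw
      linarith
  have hcmp : ∀ y, μ (closedBall y (6 * t)) ≤
      ENNReal.ofReal K * μ (closedBall (z y) (α * t / 8)) := by
    intro y
    refine (hμ y _ (by positivity) (by linarith)).2.trans ?_
    refine le_trans (le_of_eq ?_) (mul_le_mul_right
      (hμ (z y) (α * t / 8) (by positivity) (by linarith)).1 _)
    rw [← ENNReal.ofReal_mul hK0.le]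
    congr 1
    -- The constant `48 / α` is the quotient of the covering radius and the hole radius.
    have : (6 * t) = 48 / α * (α * t / 8) := by field_simp; norm_num
    rw [this, Real.mul_rpow (by positivity) (by positivity), hK]
    field_simp
  have hmain : μ (thickening (α / 4 * t) E) ≤
      ENNReal.ofReal K * μ (thickening t E \ thickening (α / 4 * t) E) := by
    refine hup.trans ((ENNReal.tsum_le_tsum fun y : u => hcmp y).trans ?_)
    rw [ENNReal.tsum_mul_left]
    exact mul_le_mul_right hlow _
  have hss : thickening (α / 4 * t) E ⊆ thickening t E := thickening_mono (by linarith) E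
  have hfin' : μ (thickening (α / 4 * t) E) ≠ ⊤ := ne_top_of_le_ne_top hfin (measure_mono hss)
  rw [measure_sdiff hss isOpen_thickening.measurableSet.nullMeasurableSet hfin'] at hmain
  have hle := measure_mono (μ := μ) hss
  lift μ (thickening t E) to ℝ≥0 using hfin with a
  lift μ (thickening (α / 4 * t) E) to ℝ≥0 using hfin' with c
  lift K to ℝ≥0 using hK0.le with k
  have hdr : decayRatio δ C α = ((k / (1 + k) : ℝ≥0) : ℝ) := by
    rw [decayRatio, ← hK]
    push_cast
    rfl
  rw [hdr, ENNReal.ofReal_coe_nnreal]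
  rw [ENNReal.ofReal_coe_nnreal] at hmain
  norm_cast at hmain hle ⊢
  rw [← NNReal.coe_le_coe] at hmain ⊢
  push_cast [NNReal.coe_sub hle] at hmain ⊢
  rw [div_mul_eq_mul_div, le_div_iff₀ (by positivity)]
  linarith

theorem measure_thickening_pow_le [TopologicalSpace.SeparableSpace X] [MeasurableSpace X]
    [BorelSpace X] {δ : ℝ≥0} {C α ρ t : ℝ} {μ : Measure X} (hμ : HasBallBounds δ C μ)
    (hC : 0 < C) (hα : 0 < α) (hα1 : α < 1) {E : Set X} (hE : IsUniformlyPorous α ρ E)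
    (ht : 0 < t) (htρ : t < ρ) (ht6 : t ≤ 1 / 6) (hd : ∀ x ∈ E, E ⊆ closedBall x (1 / 2)) (k : ℕ) :
    μ (thickening ((α / 4) ^ k * t) E) ≤
      ENNReal.ofReal (decayRatio δ C α) ^ k * ENNReal.ofReal C := by
  have h0 : μ (thickening t E) ≤ ENNReal.ofReal C := by
    rcases E.eq_empty_or_nonempty with rfl | ⟨x, hxE⟩
    · simp
    have := (hμ x 1 one_pos le_rfl).2
    rw [Real.one_rpow, mul_one] at this
    refine (measure_mono fun w hw => ?_).trans this
    obtain ⟨e, he, hwe⟩ := mem_thickening_iff.1 hw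
    have h1 := mem_closedBall.1 (hd x hxE he)
    have := dist_triangle w e x
    rw [mem_closedBall]
    linarith
  have hpow : ∀ k : ℕ, (α / 4) ^ k * t ≤ t := fun k =>
    mul_le_of_le_one_left ht.le (pow_le_one₀ (by positivity) (by linarith))
  induction k with
  | zero => simpa using h0
  | succ k ih =>
    have hk := hpow k
    have := measure_thickening_le hμ hC hα hα1 hE (t := (α / 4) ^ k * t) (by positivity)
      (hk.trans_lt htρ) (hk.trans ht6)
      (ne_top_of_le_ne_top ENNReal.ofReal_ne_top ((measure_mono (thickening_mono hk E)).trans h0))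
    rw [pow_succ', mul_assoc, pow_succ', mul_assoc]
    exact this.trans (mul_le_mul_right ih _)

/-- A point of `E` would keep the measure of every thickening at least `C⁻¹`, against geometric
decay. -/
theorem IsUniformlyPorous.eq_empty [TopologicalSpace.SeparableSpace X] [MeasurableSpace X]
    [BorelSpace X] {C α ρ : ℝ} {μ : Measure X} (hμ : HasBallBounds 0 C μ)
    (hC : 0 < C) (hα : 0 < α) (hα1 : α < 1) {E : Set X} (hρ : 0 < ρ)
    (hE : IsUniformlyPorous α ρ E) (hd : ∀ x ∈ E, E ⊆ closedBall x (1 / 2)) : E = ∅ := by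
  by_contra hne
  obtain ⟨y, hy⟩ := Set.nonempty_iff_ne_empty.2 hne
  set t := min (ρ / 2) (1 / 6) with ht
  have ht0 : 0 < t := lt_min (by positivity) (by norm_num)
  have htρ : t < ρ := (min_le_left _ _).trans_lt (by linarith)
  have ht6 : t ≤ 1 / 6 := min_le_right _ _
  have hlow : ∀ k : ℕ, ENNReal.ofReal C⁻¹ ≤
      ENNReal.ofReal (decayRatio 0 C α) ^ k * ENNReal.ofReal C := by
    intro k
    refine le_trans ?_ (measure_thickening_pow_le hμ hC hα hα1 hE ht0 htρ ht6 hd k)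
    have hs : 0 < (α / 4) ^ k * t := by positivity
    have hs1 : (α / 4) ^ k * t ≤ 1 :=
      (mul_le_of_le_one_left ht0.le (pow_le_one₀ (by positivity) (by linarith))).trans
        (by linarith)
    have := (hμ y ((α / 4) ^ k * t / 2) (by positivity) (by linarith)).1
    simp only [NNReal.coe_zero, Real.rpow_zero, mul_one] at this
    refine this.trans (measure_mono ?_)
    exact (closedBall_subset_ball (by linarith)).trans (ball_subset_thickening hy _)
  have hlim := ENNReal.Tendsto.mul_const (b := ENNReal.ofReal C)
    (ENNReal.tendsto_pow_atTop_nhds_zero_of_lt_one (r := ENNReal.ofReal (decayRatio 0 C α))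
      (by simpa using decayRatio_lt_one hC hα)) (Or.inr ENNReal.ofReal_ne_top)
  rw [zero_mul] at hlim
  have := ge_of_tendsto' hlim hlow
  simp [hC.not_ge] at this

theorem exists_dimension_lt {δ : ℝ≥0} (hδ : 0 < δ) {l γ : ℝ} (hl : l < 1) (hγ : 0 < γ) :
    ∃ s < δ, l * γ ^ ((s : ℝ) - δ) < 1 := by
  have hcont : Filter.Tendsto (fun s : ℝ≥0 => l * γ ^ ((s : ℝ) - δ)) (nhds δ) (nhds l) := by
    have : Continuous fun s : ℝ≥0 => l * γ ^ ((s : ℝ) - δ) :=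
      continuous_const.mul (continuous_const.rpow (by fun_prop) fun _ => Or.inl hγ.ne')
    simpa using this.tendsto δ
  have hev := hcont.eventually_lt_const hl
  obtain ⟨a, ha, h⟩ := exists_Ioc_subset_of_mem_nhds hev ⟨0, hδ⟩
  obtain ⟨s, hs1, hs2⟩ := exists_between ha
  exact ⟨s, hs2, h ⟨hs1, hs2.le⟩⟩

/-- The packing balls are sorted by diameter into scales `γ ^ k * t`. At each scale they are
disjoint inside a thickening of `E`, so its measure bounds their contribution, and `hs` makes the
sum over scales a convergent geometric series. -/
theorem IsUniformlyPorous.packingPremeasure_lt_top [TopologicalSpace.SeparableSpace X]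
    [MeasurableSpace X] [BorelSpace X] {δ s : ℝ≥0} {C α ρ : ℝ} {μ : Measure X}
    (hμ : HasBallBounds δ C μ) (hC : 0 < C) (hα : 0 < α) (hα1 : α < 1) {E : Set X} (hρ : 0 < ρ)
    (hE : IsUniformlyPorous α ρ E) (hd : ∀ x ∈ E, E ⊆ closedBall x (1 / 2)) (hsδ : s < δ)
    (hs : decayRatio δ C α * (α / 4) ^ ((s : ℝ) - δ) < 1) : packingPremeasure s E < ⊤ := by
  set t := min (ρ / 2) (1 / 6) with ht
  have ht0 : 0 < t := lt_min (by positivity) (by norm_num)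
  have htρ : t < ρ := (min_le_left _ _).trans_lt (by linarith)
  have ht6 : t ≤ 1 / 6 := min_le_right _ _
  set γ := α / 4 with hγ
  have hγ0 : 0 < γ := by positivity
  have hγ1 : γ < 1 := by rw [hγ]; linarith
  have hl := decayRatio_pos (δ := δ) hC hα
  set l := decayRatio δ C α with hldef
  set a : ℕ → ℝ≥0∞ := fun k => ENNReal.ofReal (2 ^ (δ : ℝ) * C * (γ ^ (k + 1) * t) ^ ((s : ℝ) - δ))
    with ha
  set D : ℝ := 2 ^ (δ : ℝ) * C * (γ * t) ^ ((s : ℝ) - δ) * C with hD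
  have hak : ∀ k, a k * μ (thickening (γ ^ k * t) E) ≤
      ENNReal.ofReal D * ENNReal.ofReal (l * γ ^ ((s : ℝ) - δ)) ^ k := by
    intro k
    refine (mul_le_mul_right (measure_thickening_pow_le hμ hC hα hα1 hE ht0 htρ ht6 hd k)
      _).trans_eq ?_
    rw [← hldef, ← ENNReal.ofReal_pow hl.le, ← ENNReal.ofReal_pow (by positivity), ha,
      ← ENNReal.ofReal_mul (by positivity), ← ENNReal.ofReal_mul (by positivity),
      ← ENNReal.ofReal_mul (by positivity)]
    congr 1
    have : γ ^ (k + 1) * t = γ ^ k * (γ * t) := by ring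
    rw [this, Real.mul_rpow (by positivity) (by positivity), hD, mul_pow, ← Real.rpow_natCast,
      ← Real.rpow_natCast, ← Real.rpow_natCast, ← Real.rpow_mul hγ0.le, ← Real.rpow_mul hγ0.le,
      mul_comm (k : ℝ)]
    ring
  have hsum : ∑' k, a k * μ (thickening (γ ^ k * t) E) < ⊤ := by
    refine (ENNReal.tsum_le_tsum hak).trans_lt ?_
    rw [ENNReal.tsum_mul_left, ENNReal.tsum_geometric]
    refine ENNReal.mul_lt_top ENNReal.ofReal_lt_top (ENNReal.inv_lt_top.2 (tsub_pos_of_lt ?_))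
    simpa using hs
  -- Radii at most `t / 2` give diameters at most `t`, so the scale index starts at `0`.
  refine lt_of_le_of_lt (iInf₂_le (t / 2) (by positivity)) (lt_of_le_of_lt (iSup₂_le ?_) hsum)
  intro P hP
  have hscale : ∀ p ∈ P, ∃ k : ℕ, γ ^ (k + 1) * t < 2 * p.2 ∧ 2 * p.2 ≤ γ ^ k * t := by
    intro p hp
    obtain ⟨-, h1, h2⟩ := hP.1 p hp
    obtain ⟨k, hk1, hk2⟩ := exists_nat_pow_near_of_lt_one (x := 2 * p.2 / t) (by positivity)
      (by rw [div_le_one ht0]; linarith) hγ0 hγ1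
    exact ⟨k, (lt_div_iff₀ ht0).1 hk1, (div_le_iff₀ ht0).1 hk2⟩
  choose! κ hκ1 hκ2 using hscale
  have hterm : ∀ p ∈ P, ENNReal.ofReal ((2 * p.2) ^ (s : ℝ)) ≤
      a (κ p) * μ (closedBall p.1 p.2) := by
    intro p hp
    obtain ⟨-, h1, h2⟩ := hP.1 p hp
    refine le_trans ?_ (mul_le_mul_right (hμ p.1 p.2 h1 (by linarith)).1 _)
    rw [ha, ← ENNReal.ofReal_mul (by positivity)]
    refine ENNReal.ofReal_le_ofReal ?_
    have e1 : (2 * p.2) ^ (s : ℝ) = (2 * p.2) ^ ((s : ℝ) - δ) * (2 ^ (δ : ℝ) * p.2 ^ (δ : ℝ)) := by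
      rw [← Real.mul_rpow (by positivity) h1.le, ← Real.rpow_add (by positivity)]
      congr 1
      ring
    -- The exponent `s - δ` is nonpositive, so the lower end of the scale gives the upper bound.
    have e2 : (2 * p.2) ^ ((s : ℝ) - δ) ≤ (γ ^ (κ p + 1) * t) ^ ((s : ℝ) - δ) :=
      Real.rpow_le_rpow_of_nonpos (by positivity) (hκ1 p hp).le
        (sub_nonpos.2 (by exact_mod_cast hsδ.le))
    rw [e1]
    refine (mul_le_mul_of_nonneg_right e2 (by positivity)).trans_eq ?_
    field_simp
  classical
  calc ∑ p ∈ P, ENNReal.ofReal ((2 * p.2) ^ (s : ℝ))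
      ≤ ∑ p ∈ P, a (κ p) * μ (closedBall p.1 p.2) := Finset.sum_le_sum hterm
    _ = ∑ k ∈ P.image κ, ∑ p ∈ P with κ p = k, a (κ p) * μ (closedBall p.1 p.2) :=
        (Finset.sum_fiberwise_of_maps_to (fun p hp => Finset.mem_image_of_mem κ hp) _).symm
    _ ≤ ∑ k ∈ P.image κ, a k * μ (thickening (γ ^ k * t) E) := by
        refine Finset.sum_le_sum fun k _ => ?_
        have hdisj : ((P.filter fun p => κ p = k : Finset (X × ℝ)) : Set (X × ℝ)).PairwiseDisjoint
            fun p => closedBall p.1 p.2 := hP.2.subset fun p hp => (Finset.mem_filter.1 hp).1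
        rw [Finset.sum_congr rfl (g := fun p => a k * μ (closedBall p.1 p.2))
            fun p hp => by rw [(Finset.mem_filter.1 hp).2],
          ← Finset.mul_sum, ← measure_biUnion_finset hdisj fun _ _ => measurableSet_closedBall]
        refine mul_le_mul_right (measure_mono (Set.iUnion₂_subset fun p hp => ?_)) _
        obtain ⟨hpP, rfl⟩ := Finset.mem_filter.1 hp
        obtain ⟨h0, h1, h2⟩ := hP.1 p hpP
        have := hκ2 p hpP
        exact (closedBall_subset_ball (by linarith)).trans (ball_subset_thickening h0 _)
    _ ≤ ∑' k, a k * μ (thickening (γ ^ k * t) E) := ENNReal.sum_le_tsum _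

theorem exists_packing_bound {s : ℝ≥0} {E : Set X} (h : packingPremeasure s E < ⊤) :
    ∃ ε > 0, ∃ M : ℝ≥0, ∀ P, IsPacking ε E P →
      ∑ p ∈ P, ENNReal.ofReal ((2 * p.2) ^ (s : ℝ)) ≤ M := by
  simp only [packingPremeasure, iInf_lt_iff] at h
  obtain ⟨ε, hε, h⟩ := h
  lift (⨆ (P : Finset (X × ℝ)) (_ : IsPacking ε E P),
    ∑ p ∈ P, ENNReal.ofReal ((2 * p.2) ^ (s : ℝ))) to ℝ≥0 using h.ne with M hM
  refine ⟨ε, hε, M, fun P hP => ?_⟩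
  rw [hM]
  exact le_iSup₂ (f := fun (P : Finset (X × ℝ)) (_ : IsPacking ε E P) =>
    ∑ p ∈ P, ENNReal.ofReal ((2 * p.2) ^ (s : ℝ))) P hP

/-- For radii at most `η`, passing from `s` to `s'` gains a factor `(2 * η) ^ (s' - s)`, which tends
to `0`. -/
theorem packingPremeasure_eq_zero {s s' : ℝ≥0} {E : Set X} (h : packingPremeasure s E < ⊤)
    (hs : s < s') : packingPremeasure s' E = 0 := by
  obtain ⟨ε, hε, M, hM⟩ := exists_packing_bound h
  have hs0 : (0 : ℝ) < s' - s := sub_pos.2 (by exact_mod_cast hs)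
  have hbd : ∀ η : ℝ, 0 < η → η ≤ ε →
      packingPremeasure s' E ≤ ENNReal.ofReal ((2 * η) ^ ((s' : ℝ) - s)) * M := by
    intro η hη hηε
    refine (iInf₂_le η hη).trans (iSup₂_le fun P hP => ?_)
    refine le_trans ?_ (mul_le_mul_right
      (hM P ⟨fun p hp => ⟨(hP.1 p hp).1, (hP.1 p hp).2.1, (hP.1 p hp).2.2.trans hηε⟩, hP.2⟩) _)
    rw [Finset.mul_sum]
    refine Finset.sum_le_sum fun p hp => ?_
    obtain ⟨-, h1, h2⟩ := hP.1 p hp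
    rw [← ENNReal.ofReal_mul (by positivity)]
    refine ENNReal.ofReal_le_ofReal ?_
    have e1 : (2 * p.2) ^ (s' : ℝ) = (2 * p.2) ^ ((s' : ℝ) - s) * (2 * p.2) ^ (s : ℝ) := by
      rw [← Real.rpow_add (by positivity)]
      congr 1
      ring
    rw [e1]
    gcongr
  have hlim : Filter.Tendsto (fun η : ℝ => ENNReal.ofReal ((2 * η) ^ ((s' : ℝ) - s)) * M)
      (nhdsWithin 0 (Set.Ioi 0)) (nhds 0) := by
    have hc : Continuous fun η : ℝ => ENNReal.ofReal ((2 * η) ^ ((s' : ℝ) - s)) :=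
      ENNReal.continuous_ofReal.comp
        ((continuous_const.mul continuous_id).rpow_const fun _ => Or.inr hs0.le)
    have := ENNReal.Tendsto.mul_const (b := (M : ℝ≥0∞)) (hc.tendsto 0) (Or.inr ENNReal.coe_ne_top)
    simp only [mul_zero, Real.zero_rpow hs0.ne', ENNReal.ofReal_zero, zero_mul] at this
    exact this.mono_left nhdsWithin_le_nhds
  refine le_antisymm (ge_of_tendsto hlim ?_) zero_le
  filter_upwards [Ioc_mem_nhdsGT hε] with η hη using hbd η hη.1 hη.2

/-- A Vitali family of balls of one small radius is a packing, and its fivefold enlargement is a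
cover. Hence the Hausdorff measure is at most `5 ^ s` times the packing bound. -/
theorem dimH_le_of_packingPremeasure_lt_top [TopologicalSpace.SeparableSpace X] {s : ℝ≥0}
    {E : Set X} (h : packingPremeasure s E < ⊤) : dimH E ≤ s := by
  borelize X
  obtain ⟨ε, hε, M, hM⟩ := exists_packing_bound h
  set t : ℕ → ℝ := fun n => ε / ((n : ℝ) + 1) with ht
  have ht0 : ∀ n, 0 < t n := fun n => by positivity
  have htε : ∀ n, t n ≤ ε := fun n => div_le_self hε.le (by linarith [n.cast_nonneg (α := ℝ)])
  have hV := fun n => Vitali.exists_disjoint_subfamily_covering_enlargement_closedBall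
    E id (fun _ => t n) (t n) (fun _ _ => le_rfl) 5 (by norm_num)
  choose u huE hdisj hcov using hV
  have hu : ∀ n, Countable (u n) := fun n =>
    ((hdisj n).countable_of_nonempty_interior fun y _ =>
      ⟨y, ball_subset_interior_closedBall (mem_ball_self (ht0 n))⟩).to_subtype
  have hdiam : ∀ n (y : X), ediam (closedBall y (5 * t n)) ≤ ENNReal.ofReal (5 * (2 * t n)) := by
    intro n y
    refine ediam_le fun a ha b hb => ?_
    rw [edist_dist]
    refine ENNReal.ofReal_le_ofReal ?_
    have := dist_triangle_right a b y
    rw [mem_closedBall] at ha hb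
    linarith
  have hbound : ∀ n, ∑' y : u n, ediam (closedBall (y : X) (5 * t n)) ^ (s : ℝ) ≤
      ENNReal.ofReal (5 ^ (s : ℝ)) * M := by
    intro n
    have h1 : ∀ y : u n, ediam (closedBall (y : X) (5 * t n)) ^ (s : ℝ) ≤
        ENNReal.ofReal (5 ^ (s : ℝ)) * ENNReal.ofReal ((2 * t n) ^ (s : ℝ)) := by
      intro y
      refine (ENNReal.rpow_le_rpow (hdiam n y) s.coe_nonneg).trans_eq ?_
      have := ht0 n
      rw [ENNReal.ofReal_rpow_of_pos (by positivity), Real.mul_rpow (by norm_num) (by positivity),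
        ENNReal.ofReal_mul (by positivity)]
    refine (ENNReal.tsum_le_tsum h1).trans ?_
    rw [ENNReal.tsum_mul_left]
    refine mul_le_mul_right ?_ _
    rw [ENNReal.tsum_eq_iSup_sum]
    refine iSup_le fun F => ?_
    let ψ : u n ↪ X × ℝ := ⟨fun y => (y, t n), fun a b hab => Subtype.ext (Prod.ext_iff.1 hab).1⟩
    have := hM (F.map ψ) ⟨?_, ?_⟩
    · rwa [Finset.sum_map] at this
    · intro p hp
      obtain ⟨y, -, rfl⟩ := Finset.mem_map.1 hp
      exact ⟨huE n y.2, ht0 n, htε n⟩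
    · intro p hp q hq hpq
      obtain ⟨y, -, rfl⟩ := Finset.mem_map.1 hp
      obtain ⟨w, -, rfl⟩ := Finset.mem_map.1 hq
      exact hdisj n y.2 w.2 fun hyw => hpq (by rw [Subtype.ext hyw])
  have htlim : Filter.Tendsto (fun n => ENNReal.ofReal (5 * (2 * t n))) Filter.atTop (nhds 0) := by
    have h1 : Filter.Tendsto t Filter.atTop (nhds 0) := by
      have := (tendsto_one_div_add_atTop_nhds_zero_nat (𝕜 := ℝ)).const_mul ε
      simpa [ht, div_eq_mul_inv] using this
    simpa using ENNReal.tendsto_ofReal ((h1.const_mul 2).const_mul 5)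
  refine dimH_le_of_hausdorffMeasure_ne_top (ne_top_of_le_ne_top
    (b := ENNReal.ofReal (5 ^ (s : ℝ)) * M)
    (ENNReal.mul_ne_top ENNReal.ofReal_ne_top ENNReal.coe_ne_top) ?_)
  refine (Measure.hausdorffMeasure_le_liminf_tsum (s : ℝ) E (l := Filter.atTop)
    (fun n => ENNReal.ofReal (5 * (2 * t n))) htlim
    (fun n (y : u n) => closedBall (y : X) (5 * t n)) (Filter.Eventually.of_forall fun n y =>
      hdiam n y) (Filter.Eventually.of_forall fun n e he => ?_)).trans ?_
  · obtain ⟨y, hy, hey⟩ := hcov n e he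
    exact Set.mem_iUnion.2 ⟨⟨y, hy⟩, hey (mem_closedBall_self (ht0 n).le)⟩
  · exact (Filter.liminf_le_liminf (Filter.Eventually.of_forall hbound)).trans_eq
      (Filter.liminf_const _)

end Dimension

theorem mainTheorem6 {X : Type*} [MetricSpace X] [CompleteSpace X]
    [TopologicalSpace.SeparableSpace X] [MeasurableSpace X] [BorelSpace X]
    (δ : ℝ≥0) (hX : IsAhlforsRegular δ (Set.univ : Set X))
    (T : Set X) (hT : IsBMSWinning T) :
    (0 < δ → dimH Tᶜ < δ ∧ packingDim Tᶜ < δ) ∧ (δ = 0 → Tᶜ = ∅) := by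
  obtain ⟨-, μ, -, C, hC, hμ⟩ := hX
  replace hμ : HasBallBounds δ C μ := fun x r => hμ x (Set.mem_univ x) r
  obtain ⟨β, hβ, hβ1, hwin⟩ : ∃ β : ℝ, 0 < β ∧ β < 1 ∧ IsBMSWinningWith β T := by
    obtain ⟨β₀, hβ₀, h⟩ := hT
    have h1 : 0 < min β₀ 1 := lt_min hβ₀ one_pos
    refine ⟨min β₀ 1 / 2, by positivity, ?_, h _ (by positivity) ?_ ?_⟩
    all_goals linarith [min_le_left β₀ 1, min_le_right β₀ 1]
  obtain ⟨E, hcov, hE⟩ := hwin.exists_porous_cover hβ hβ1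
  have hα : 0 < β / 2 := by positivity
  have hα1 : β / 2 < 1 := by linarith
  refine ⟨fun hδ => ?_, ?_⟩
  · obtain ⟨s, hsδ, hs⟩ := exists_dimension_lt hδ (decayRatio_lt_one (δ := δ) hC hα)
      (show 0 < β / 2 / 4 by positivity)
    have hfin : ∀ i, packingPremeasure s (E i) < ⊤ := by
      intro i
      obtain ⟨⟨ρ, hρ, h⟩, hd⟩ := hE i
      exact h.packingPremeasure_lt_top hμ hC hα hα1 hρ hd hsδ hs
    constructor
    · refine lt_of_le_of_lt ((dimH_mono hcov).trans ?_) (ENNReal.coe_lt_coe.2 hsδ)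
      rw [dimH_iUnion]
      exact iSup_le fun i => dimH_le_of_packingPremeasure_lt_top (hfin i)
    -- Finite premeasure at `s` is not summable over the pieces; at `s'` each term vanishes.
    · obtain ⟨s', hs', hs'δ⟩ := exists_between hsδ
      refine lt_of_le_of_lt (iInf₂_le s' ?_) (ENNReal.coe_lt_coe.2 hs'δ)
      refine le_antisymm ((iInf₂_le E hcov).trans_eq ?_) zero_le
      simp [packingPremeasure_eq_zero (hfin _) hs']
  · rintro rfl
    refine Set.subset_eq_empty hcov (Set.iUnion_eq_empty.2 fun i => ?_)
    obtain ⟨⟨ρ, hρ, h⟩, hd⟩ := hE i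
    exact h.eq_empty hμ hC hα hα1 hρ hd
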